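/- Let $n \ge 2$ and let $T$ be the path of length $n$ with node set $V=\{0,\dots,n\}$ and edges $\{i,i+1\}$, $0\le i\le n-1$. For real variables $x_{ij}=x_{ji}$ indexed by the pairs $\{i,j\}\in\binom{V}{2}$, consider the system \begin{align*} x_{0n} &\le 1, \\ x_{in} &\le x_{i-1,n} && \text{for all } i\in\{1,\dots,n-1\}, \\ x_{0i} &\le x_{0,i+1} && \text{for all } i\in\{1,\dots,n-1\}, \\ x_{i-1,i+1} &\le x_{i-1,i}+x_{i,i+1} && \text{for all } i\in\{1,\dots,n-1\}, \\ x_{jk}+x_{j+1,k-1} &\le x_{j+1,k}+x_{j,k-1} && \text{for all } j,k\in\{0,\dots,n\} \text{ with } j<k-2, \end{align*} and write it as $Ax\le\alpha$ with all variables on the left-hand side. Let $\mathrm{PPP}(n)\subseteq\mathbb{R}^{\binom{V}{2}}$ be its set of real solutions. Let $\mathrm{LMC}(T)\subseteq\mathbb{R}^{\binom{V}{2}}$ be the convex hull of the characteristic vectors of the multicuts of the complete graph on $V$ lifted from $T$, i.e. of the sets of all pairs $\{u,v\}$ whose nodes lie in distinct classes of $\Pi$, where $\Pi$ ranges over the partitions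 of $V$ into sets that induce connected subgraphs of $T$. Then: 1. The system $Ax\le\alpha$ is totally dual integral: for every integral vector $c$ for which $\max\{c^\top x \mid Ax\le\alpha\}$ is finite, the dual linear program $\min\{y^\top\alpha \mid y\ge 0,\ y^\top A=c^\top\}$ has an integral optimal solution. 2. $\mathrm{LMC}(T)=\mathrm{PPP}(n)$. -/

import Mathlib

namespace LiftedMulticut

section Multicuts

variable {V : Type*}

/-- A decomposition of `G`: a partition of the node set into sets that induce connected
subgraphs of `G`. -/
def IsDecomposition (G : SimpleGraph V) (P : Set (Set V)) : Prop :=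
  Setoid.IsPartition P ∧ ∀ U ∈ P, (G.induce U).Connected

/-- The edges `uv` of `H` that straddle distinct classes of the partition `P`, that is, such that
no `U ∈ P` contains both `u` and `v`. -/
def straddling (H : SimpleGraph V) (P : Set (Set V)) : Set (Sym2 V) :=
  {e | e ∈ H.edgeSet ∧ ∀ U ∈ P, ∃ v ∈ e, v ∉ U}

/-- `M` is a multicut of the augmentation `H` lifted from `G`: it consists of the edges of `H` that
straddle distinct components of some decomposition of `G`. -/
def IsLiftedMulticut (G H : SimpleGraph V) (M : Set (Sym2 V)) : Prop :=
  ∃ P : Set (Set V), IsDecomposition G P ∧ M = straddling H P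

/-- The characteristic vector of a set of edges of `H`. -/
noncomputable def charVec (H : SimpleGraph V) (M : Set (Sym2 V)) : H.edgeSet → ℝ :=
  fun e => M.indicator 1 (e : Sym2 V)

/-- The lifted multicut polytope with respect to `G` and the augmentation `H`. -/
noncomputable def lmcAug (G H : SimpleGraph V) : Set (H.edgeSet → ℝ) :=
  convexHull ℝ {x | ∃ M, IsLiftedMulticut G H M ∧ x = charVec H M}

/-- The lifted multicut polytope with respect to `G` and the complete graph on its nodes. -/
noncomputable def lmc (G : SimpleGraph V) : Set ((⊤ : SimpleGraph V).edgeSet → ℝ) :=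
  lmcAug G ⊤

end Multicuts

section LinearSystems

variable {ι κ : Type*} [Fintype ι] [Fintype κ]

/-- The real solutions of the rational system `A x ≤ b`. -/
def solutions (A : Matrix ι κ ℚ) (b : ι → ℚ) : Set (κ → ℝ) :=
  {x | ∀ i, ∑ e, (A i e : ℝ) * x e ≤ (b i : ℝ)}

/-- The feasible points `y ≥ 0`, `yᵀ A = cᵀ` of the dual of `max {cᵀ x | A x ≤ b}`. -/
def dualFeasible (A : Matrix ι κ ℚ) (c : κ → ℤ) : Set (ι → ℝ) :=
  {y | (∀ i, 0 ≤ y i) ∧ ∀ e, ∑ i, y i * (A i e : ℝ) = (c e : ℝ)}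

/-- Total dual integrality of the rational system `A x ≤ b`: for every integral `c` for which the
linear program `max {cᵀ x | A x ≤ b}` is feasible and bounded, the dual program
`min {yᵀ b | y ≥ 0, yᵀ A = cᵀ}` has an integral optimal solution. -/
def IsTotallyDualIntegral (A : Matrix ι κ ℚ) (b : ι → ℚ) : Prop :=
  ∀ c : κ → ℤ, (solutions A b).Nonempty →
    BddAbove ((fun x : κ → ℝ => ∑ e, (c e : ℝ) * x e) '' solutions A b) →
    ∃ y : ι → ℤ, (fun i => (y i : ℝ)) ∈ dualFeasible A c ∧
      ∀ z ∈ dualFeasible A c, ∑ i, (y i : ℝ) * (b i : ℝ) ≤ ∑ i, z i * (b i : ℝ)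

end LinearSystems

section Paths

/-- The path of length `n`, with nodes `0, …, n` and edges `{i, i + 1}`. -/
abbrev path (n : ℕ) : SimpleGraph (Fin (n + 1)) := SimpleGraph.pathGraph (n + 1)

/-- The pairs of distinct nodes in `{0, …, n}`. -/
abbrev Pairs (n : ℕ) : Type := ((⊤ : SimpleGraph (Fin (n + 1))).edgeSet : Set (Sym2 (Fin (n + 1))))

/-- The coefficient vector of the linear form `x ↦ x_{ij}`, for distinct `i, j ∈ {0, …, n}`. -/
def coord (n i j : ℕ) : Pairs n → ℚ :=
  fun e => if (e : Sym2 (Fin (n + 1))).map Fin.val = s(i, j) then 1 else 0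

theorem sum_coord_mul {n : ℕ} (i j : Fin (n + 1)) (h : i ≠ j) (x : Pairs n → ℝ) :
    ∑ e, (coord n i j e : ℝ) * x e = x ⟨s(i, j), by simpa using h⟩ := by
  rw [Finset.sum_eq_single_of_mem ⟨s(i, j), by simpa using h⟩ (Finset.mem_univ _)]
  · simp [coord]
  · intro e _ he
    have hne : (e : Sym2 (Fin (n + 1))).map Fin.val ≠ s((i : ℕ), (j : ℕ)) := by
      intro h'
      apply he
      apply Subtype.ext
      apply Sym2.map.injective Fin.val_injective
      rw [h', Sym2.map_mk]
    simp [coord, hne]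

/-- The inner nodes `1, …, n - 1` of the path. -/
abbrev Inner (n : ℕ) : Type := {i : ℕ // i ∈ Finset.Ioo 0 n}

/-- The pairs of nodes `j, k` with `j < k - 2`. -/
abbrev FarPairs (n : ℕ) : Type := {p : Fin (n + 1) × Fin (n + 1) // (p.1 : ℕ) + 2 < (p.2 : ℕ)}

/-- The index set of the inequalities, listed in the order of `pathMatrix`. -/
abbrev PathRows (n : ℕ) : Type := Unit ⊕ Inner n ⊕ Inner n ⊕ Inner n ⊕ FarPairs n

/-- The left-hand sides of the system
* `x_{0n} ≤ 1`,
* `x_{in} - x_{i-1,n} ≤ 0` for `1 ≤ i ≤ n - 1`,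
* `x_{0i} - x_{0,i+1} ≤ 0` for `1 ≤ i ≤ n - 1`,
* `x_{i-1,i+1} - x_{i-1,i} - x_{i,i+1} ≤ 0` for `1 ≤ i ≤ n - 1`,
* `x_{jk} + x_{j+1,k-1} - x_{j+1,k} - x_{j,k-1} ≤ 0` for `0 ≤ j`, `k ≤ n`, `j < k - 2`. -/
def pathMatrix (n : ℕ) : Matrix (PathRows n) (Pairs n) ℚ
  | .inl _ => coord n 0 n
  | .inr (.inl i) => coord n (i : ℕ) n - coord n ((i : ℕ) - 1) n
  | .inr (.inr (.inl i)) => coord n 0 (i : ℕ) - coord n 0 ((i : ℕ) + 1)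
  | .inr (.inr (.inr (.inl i))) =>
      coord n ((i : ℕ) - 1) ((i : ℕ) + 1) - coord n ((i : ℕ) - 1) (i : ℕ)
        - coord n (i : ℕ) ((i : ℕ) + 1)
  | .inr (.inr (.inr (.inr p))) =>
      coord n (p.1.1 : ℕ) (p.1.2 : ℕ) + coord n ((p.1.1 : ℕ) + 1) ((p.1.2 : ℕ) - 1)
        - coord n ((p.1.1 : ℕ) + 1) (p.1.2 : ℕ) - coord n (p.1.1 : ℕ) ((p.1.2 : ℕ) - 1)

/-- The right-hand sides of the system. -/
def pathRhs (n : ℕ) : PathRows n → ℚ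
  | .inl _ => 1
  | .inr _ => 0

/-- The path partition polytope: all real vectors that satisfy the system. -/
def ppp (n : ℕ) : Set (Pairs n → ℝ) := solutions (pathMatrix n) (pathRhs n)

end Paths

end LiftedMulticut

/-! A decomposition of the path cuts `0, …, n` into intervals, so a multicut of maximum weight is a
partition into blocks of minimum total inner weight. This is a shortest path problem from `0` to `n
+ 1`, where a step from `j` to `k` stands for the block `{j, …, k - 1}`.

The slack of each row at a multicut indicates one block, and every block but `{0}` and `{n}` has a
row. Dual variables are thus functions `S` of blocks. If `S` vanishes on `{0}`, `{n}` and empty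
blocks, its combination of the rows is the second difference of `S` (`sum_rowVec_mul_pathMatrix`).
Inner weights have second difference `c` (`blockWeight_second_difference`), and adding a difference
of potentials does not change it. Shortest distances, adjusted at one node, make the reduced cost of
every block nonnegative. The dual value `S 0 n` is then total weight minus minimum inner weight,
which is the weight of a multicut (`exists_dual_certificate`).

The construction only adds and subtracts entries of `c`, so it stays in any subgroup of the reals
containing them. The integers give total dual integrality; all reals give the equality of polytopes,
since a hyperplane separating a solution from the hull would violate weak duality. -/

namespace LiftedMulticut

/-! ### Block weights and shortest paths -/

section WeightedIntervals

/-- The total weight of the pairs `a < b < m` that satisfy the relation `r`. -/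
noncomputable def pairWeight (D : ℕ → ℕ → ℝ) (r : ℕ → ℕ → Prop)
    [∀ a b, Decidable (r a b)] (m : ℕ) : ℝ :=
  ∑ b ∈ Finset.range m, ∑ a ∈ Finset.range b, if r a b then D a b else 0

/-- The total weight of the pairs `j ≤ a < b < m`. -/
noncomputable def blockWeight (D : ℕ → ℕ → ℝ) (j m : ℕ) : ℝ :=
  pairWeight D (fun a _ => j ≤ a) m

theorem pairWeight_succ (D : ℕ → ℕ → ℝ) (r : ℕ → ℕ → Prop) [∀ a b, Decidable (r a b)]
    (m : ℕ) :
    pairWeight D r (m + 1) = pairWeight D r m +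
      ∑ a ∈ Finset.range m, if r a m then D a m else 0 := by
  simp [pairWeight, Finset.sum_range_succ]

theorem pairWeight_congr {D : ℕ → ℕ → ℝ} {r r' : ℕ → ℕ → Prop}
    [∀ a b, Decidable (r a b)] [∀ a b, Decidable (r' a b)] {m : ℕ}
    (h : ∀ a b, a < b → b < m → (r a b ↔ r' a b)) : pairWeight D r m = pairWeight D r' m := by
  unfold pairWeight
  refine Finset.sum_congr rfl fun b hb => Finset.sum_congr rfl fun a ha => ?_
  simp only [h a b (Finset.mem_range.1 ha) (Finset.mem_range.1 hb)]

theorem pairWeight_mem {T : AddSubgroup ℝ} {D : ℕ → ℕ → ℝ} (hD : ∀ a b, D a b ∈ T)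
    (r : ℕ → ℕ → Prop) [∀ a b, Decidable (r a b)] (m : ℕ) : pairWeight D r m ∈ T := by
  refine sum_mem fun b _ => sum_mem fun a _ => ?_
  split_ifs
  · exact hD a b
  · exact T.zero_mem

theorem blockWeight_eq_zero (D : ℕ → ℕ → ℝ) {j m : ℕ} (h : m ≤ j + 1) :
    blockWeight D j m = 0 := by
  unfold blockWeight pairWeight
  refine Finset.sum_eq_zero fun b hb => Finset.sum_eq_zero fun a ha => if_neg ?_
  simp only [Finset.mem_range] at hb ha
  omega

/-- Inclusion–exclusion: among the pairs inside `{j, …, k}`, only `{j, k}` lies in neither of the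
two blocks obtained by dropping an end. -/
theorem blockWeight_second_difference (D : ℕ → ℕ → ℝ) {j k : ℕ} (h : j < k) :
    blockWeight D j (k + 1) - blockWeight D (j + 1) (k + 1) - blockWeight D j k
      + blockWeight D (j + 1) k = D j k := by
  have key : (∑ a ∈ Finset.range k, if j ≤ a then D a k else 0)
      - (∑ a ∈ Finset.range k, if j + 1 ≤ a then D a k else 0) = D j k := by
    rw [← Finset.sum_sub_distrib, Finset.sum_eq_single_of_mem j (Finset.mem_range.2 h)]
    · simp
    · intro a _ ha
      by_cases h1 : j ≤ a
      · simp [h1, show j + 1 ≤ a by omega]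
      · simp [h1, show ¬ j + 1 ≤ a by omega]
  simp only [blockWeight, pairWeight_succ]
  linarith

/-- The length of a shortest walk from `0` to `m` that only steps upwards, where a step from `j`
to `k` has length `W j k`. -/
noncomputable def shortestDist (W : ℕ → ℕ → ℝ) : ℕ → ℝ
  | 0 => 0
  | k + 1 => (Finset.univ : Finset (Fin (k + 1))).inf' Finset.univ_nonempty
      fun j => shortestDist W j + W j (k + 1)

theorem shortestDist_zero (W : ℕ → ℕ → ℝ) : shortestDist W 0 = 0 := by
  rw [shortestDist]

theorem shortestDist_le (W : ℕ → ℕ → ℝ) {j k : ℕ} (h : j < k) :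
    shortestDist W k ≤ shortestDist W j + W j k := by
  obtain ⟨k, rfl⟩ : ∃ l, k = l + 1 := ⟨k - 1, by omega⟩
  rw [shortestDist]
  exact Finset.inf'_le (f := fun j : Fin (k + 1) => shortestDist W j + W j (k + 1))
    (Finset.mem_univ (⟨j, h⟩ : Fin (k + 1)))

theorem exists_shortestDist_eq (W : ℕ → ℕ → ℝ) {k : ℕ} (h : 0 < k) :
    ∃ j < k, shortestDist W k = shortestDist W j + W j k := by
  obtain ⟨k, rfl⟩ : ∃ l, k = l + 1 := ⟨k - 1, by omega⟩
  rw [shortestDist]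
  obtain ⟨j, -, hj⟩ := Finset.exists_mem_eq_inf' (Finset.univ_nonempty (α := Fin (k + 1)))
    fun j => shortestDist W j + W j (k + 1)
  exact ⟨j, j.2, hj⟩

/-- Label each node by the first node of its block on a shortest walk. The bound `f i ≤ i` keeps
earlier labels distinct from that of a new block starting at `j`. -/
theorem exists_monotone_pairWeight_eq_shortestDist (D : ℕ → ℕ → ℝ) (m : ℕ) :
    ∃ f : ℕ → ℕ, Monotone f ∧ (∀ i, f i ≤ i) ∧
      pairWeight D (fun a b => f a = f b) m = shortestDist (blockWeight D) m := by
  induction m using Nat.strong_induction_on with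
  | _ m ih =>
    rcases Nat.eq_zero_or_pos m with rfl | hm
    · exact ⟨id, monotone_id, fun _ => le_rfl, by simp [pairWeight, shortestDist_zero]⟩
    obtain ⟨j, hj, hjm⟩ := exists_shortestDist_eq (blockWeight D) hm
    obtain ⟨f, hf, hfi, hfj⟩ := ih j hj
    refine ⟨fun i => if i < j then f i else j, ?_, ?_, ?_⟩
    · intro a b hab
      have := hf hab
      have := hfi a
      dsimp only
      split_ifs <;> omega
    · intro i
      have := hfi i
      dsimp only
      split_ifs <;> omega
    · rw [hjm, ← hfj]
      clear hjm hfj ih hm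
      induction m, hj.le using Nat.le_induction with
      | base =>
        rw [blockWeight_eq_zero D (Nat.le_succ j), add_zero]
        refine pairWeight_congr fun a b hab hb => ?_
        simp [hb, hab.trans hb]
      | succ m hm ih =>
        have ih : pairWeight D (fun a b => (if a < j then f a else j) = if b < j then f b else j) m
            = pairWeight D (fun a b => f a = f b) j + blockWeight D j m := by
          -- The induction hypothesis requires `j < m`, so the empty last block is treated
          -- separately.
          rcases hm.eq_or_lt with rfl | hm'
          · rw [blockWeight_eq_zero D (Nat.le_succ j), add_zero]
            refine pairWeight_congr fun a b hab hb => ?_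
            simp [hb, hab.trans hb]
          · exact ih hm'
        rw [blockWeight, pairWeight_succ, pairWeight_succ, ih, add_assoc]
        congr 2
        refine Finset.sum_congr rfl fun a ha => ?_
        have h1 := hfi a
        have : ((if a < j then f a else j) = if m < j then f m else j) ↔ j ≤ a := by
          split_ifs <;> omega
        exact if_congr this rfl rfl

end WeightedIntervals

end LiftedMulticut

namespace LiftedMulticut

/-! ### Decompositions of a path as interval partitions -/

section Decompositions

/-- Each step of the walk changes the node by one, so it cannot jump over `v`. -/
theorem mem_of_walk_pathGraph {m : ℕ} {U : Set (Fin m)} {u w : U}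
    (p : ((SimpleGraph.pathGraph m).induce U).Walk u w) {v : Fin m}
    (huv : u.1 ≤ v) (hvw : v ≤ w.1) : v ∈ U := by
  induction p with
  | nil => rw [le_antisymm hvw huv]; exact Subtype.prop _
  | @cons a b c hab p ih =>
    rcases huv.eq_or_lt with rfl | hlt
    · exact a.2
    · refine ih ?_ hvw
      have h : a.1.val + 1 = b.1.val ∨ b.1.val + 1 = a.1.val := SimpleGraph.pathGraph_adj.1 hab
      rw [Fin.lt_def] at hlt
      rw [Fin.le_def]
      omega

theorem induce_pathGraph_connected {m : ℕ} {U : Set (Fin m)} (hne : U.Nonempty)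
    (hU : U.OrdConnected) : ((SimpleGraph.pathGraph m).induce U).Connected := by
  have key : ∀ d : ℕ, ∀ u w : U, u.1.val + d = w.1.val →
      ((SimpleGraph.pathGraph m).induce U).Reachable u w := by
    intro d
    induction d with
    | zero =>
      intro u w h
      rw [Subtype.ext (Fin.ext h) (a1 := u)]
    | succ d ih =>
      intro u w h
      have hv : u.1.val + d < m := by omega
      have hvU : (⟨u.1.val + d, hv⟩ : Fin m) ∈ U :=
        hU.out u.2 w.2 ⟨by simp [Fin.le_def], by rw [Fin.le_def]; simp; omega⟩
      refine (ih u ⟨_, hvU⟩ rfl).trans (SimpleGraph.Adj.reachable ?_)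
      refine SimpleGraph.pathGraph_adj.2 (Or.inl ?_)
      simp only [Function.Embedding.subtype_apply]
      omega
  have : Nonempty U := hne.to_subtype
  refine SimpleGraph.Connected.mk fun u w => ?_
  rcases le_total u.1.val w.1.val with h | h
  · exact key (w.1.val - u.1.val) u w (by omega)
  · exact (key (u.1.val - w.1.val) w u (by omega)).symm

theorem exists_isLiftedMulticut_of_monotone {n : ℕ} {f : ℕ → ℕ} (hf : Monotone f) :
    ∃ M, IsLiftedMulticut (path n) ⊤ M ∧
      ∀ u v : Fin (n + 1), u ≠ v → (s(u, v) ∈ M ↔ f u ≠ f v) := by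
  set g : Fin (n + 1) → ℕ := fun u => f u with hg
  have hmono : Monotone g := fun a b h => hf h
  refine ⟨_, ⟨(Setoid.ker g).classes, ⟨Setoid.isPartition_classes _, ?_⟩, rfl⟩, ?_⟩
  · rintro U ⟨y, rfl⟩
    refine induce_pathGraph_connected ⟨y, rfl⟩ ⟨fun a ha b hb c hc => ?_⟩
    have ha : g a = g y := ha
    have hb : g b = g y := hb
    show g c = g y
    exact le_antisymm (hb ▸ hmono hc.2) (ha ▸ hmono hc.1)
  · intro u v huv
    constructor
    · rintro ⟨-, h⟩ heq
      obtain ⟨w, hw, hwn⟩ := h _ ⟨v, rfl⟩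
      rcases Sym2.mem_iff.1 hw with rfl | rfl
      · exact hwn heq
      · exact hwn rfl
    · refine fun hne => ⟨by simpa using huv, ?_⟩
      rintro U ⟨y, rfl⟩
      by_cases h : g u = g y
      · exact ⟨v, by simp, fun hv : g v = g y => hne (h.trans hv.symm)⟩
      · exact ⟨u, by simp, h⟩

/-- The classes of a decomposition of a path are the fibres of a labelling that is constant on
intervals. -/
theorem IsLiftedMulticut.exists_label {n : ℕ} {M : Set (Sym2 (Fin (n + 1)))}
    (hM : IsLiftedMulticut (path n) ⊤ M) :
    ∃ r : Fin (n + 1) → Set (Fin (n + 1)),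
      (∀ u v, u ≠ v → (s(u, v) ∈ M ↔ r u ≠ r v)) ∧
      ∀ u v w, u ≤ v → v ≤ w → r u = r w → r u = r v := by
  obtain ⟨P, ⟨hP, hconn⟩, rfl⟩ := hM
  choose r hr huniq using hP.2
  have hrP : ∀ u, r u ∈ P := fun u => (hr u).1
  have hur : ∀ u, u ∈ r u := fun u => (hr u).2
  have heq : ∀ u U, U ∈ P → u ∈ U → U = r u := fun u U h1 h2 => huniq u U ⟨h1, h2⟩
  refine ⟨r, fun u v huv => ⟨?_, ?_⟩, fun u v w huv hvw h => ?_⟩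
  · rintro ⟨-, h⟩ he
    obtain ⟨w, hw, hwn⟩ := h _ (hrP v)
    rcases Sym2.mem_iff.1 hw with rfl | rfl
    · exact hwn (he ▸ hur w)
    · exact hwn (hur w)
  · refine fun hne => ⟨by simpa using huv, fun U hU => ?_⟩
    by_cases h : u ∈ U
    · exact ⟨v, by simp, fun hv => hne ((heq u U hU h).symm.trans (heq v U hU hv))⟩
    · exact ⟨u, by simp, h⟩
  · have hw : w ∈ r u := h ▸ hur w
    obtain ⟨p⟩ := (hconn _ (hrP u)).preconnected ⟨u, hur u⟩ ⟨w, hw⟩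
    exact heq v _ (hrP u) (mem_of_walk_pathGraph p huv hvw)

end Decompositions

/-! ### The inequalities and their validity for multicuts -/

section Coordinates

variable {n : ℕ}

/-- The coordinate `x_{ij}`, and `0` unless `i` and `j` are distinct nodes. -/
noncomputable def entry (x : Pairs n → ℝ) (i j : ℕ) : ℝ := ∑ e, (coord n i j e : ℝ) * x e

theorem entry_eq (x : Pairs n → ℝ) {i j : ℕ} (hi : i < n + 1) (hj : j < n + 1) (h : i ≠ j) :
    entry x i j = x ⟨s(⟨i, hi⟩, ⟨j, hj⟩), by simpa using h⟩ :=
  sum_coord_mul ⟨i, hi⟩ ⟨j, hj⟩ (by simpa using h) x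

theorem entry_mem {T : AddSubgroup ℝ} {x : Pairs n → ℝ} (hx : ∀ e, x e ∈ T) (i j : ℕ) :
    entry x i j ∈ T := by
  refine sum_mem fun e _ => ?_
  unfold coord
  split_ifs
  · simpa using hx e
  · simp

theorem sum_pairs (g : Pairs n → ℝ) :
    ∑ e, g e = ∑ b ∈ Finset.range (n + 1), ∑ a ∈ Finset.range b, entry g a b := by
  rw [Finset.sum_sigma']
  symm
  refine Finset.sum_bij (fun q hq => ⟨s(⟨q.2, ?_⟩, ⟨q.1, ?_⟩), ?_⟩) ?_ ?_ ?_ ?_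
  · simp only [Finset.mem_sigma, Finset.mem_range] at hq; omega
  · simp only [Finset.mem_sigma, Finset.mem_range] at hq; omega
  · simp only [Finset.mem_sigma, Finset.mem_range] at hq
    simp only [SimpleGraph.mem_edgeSet, SimpleGraph.top_adj, ne_eq, Fin.mk.injEq]
    omega
  · intros; exact Finset.mem_univ _
  · rintro ⟨b, a⟩ h ⟨b', a'⟩ h' heq
    simp only [Finset.mem_sigma, Finset.mem_range] at h h'
    simp only [Subtype.mk.injEq, Sym2.eq_iff, Fin.mk.injEq] at heq
    obtain ⟨rfl, rfl⟩ : a = a' ∧ b = b' := by omega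
    rfl
  · rintro ⟨e, he⟩ -
    induction e using Sym2.ind with
    | _ u v =>
      have huv : u ≠ v := by simpa using he
      rcases lt_or_gt_of_ne huv with h | h
      · exact ⟨⟨v, u⟩, by simp only [Finset.mem_sigma, Finset.mem_range]; omega, rfl⟩
      · exact ⟨⟨u, v⟩, by simp only [Finset.mem_sigma, Finset.mem_range]; omega,
          Subtype.ext Sym2.eq_swap⟩
  · rintro ⟨b, a⟩ h
    simp only [Finset.mem_sigma, Finset.mem_range] at h
    have hne : a ≠ b := by omega
    exact entry_eq g _ _ hne

theorem sum_coord_eq_entry (x : Pairs n → ℝ) (i j : ℕ) :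
    ∑ e, (coord n i j e : ℝ) * x e = entry x i j := rfl

theorem mem_ppp_iff (x : Pairs n → ℝ) : x ∈ ppp n ↔
    entry x 0 n ≤ 1 ∧
    (∀ i, 0 < i → i < n → entry x i n ≤ entry x (i - 1) n) ∧
    (∀ i, 0 < i → i < n → entry x 0 i ≤ entry x 0 (i + 1)) ∧
    (∀ i, 0 < i → i < n → entry x (i - 1) (i + 1) ≤ entry x (i - 1) i + entry x i (i + 1)) ∧
    ∀ j k, j + 2 < k → k ≤ n →
      entry x j k + entry x (j + 1) (k - 1) ≤ entry x (j + 1) k + entry x j (k - 1) := by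
  simp only [ppp, solutions, Set.mem_ofPred_eq, Sum.forall, pathMatrix, pathRhs, Pi.sub_apply,
    Pi.add_apply, Rat.cast_sub, Rat.cast_add, sub_mul, add_mul, Finset.sum_sub_distrib,
    Finset.sum_add_distrib, Subtype.forall, Finset.mem_Ioo, Prod.forall, Fin.forall_iff, sum_coord_eq_entry,
    Rat.cast_zero, Rat.cast_one, and_imp, sub_le_iff_le_add, zero_add, forall_const]
  refine and_congr_right' <| and_congr_right' <| and_congr_right' <| and_congr ?_ ?_
  · refine forall₃_congr fun i _ _ => ?_
    rw [add_comm (entry x (i - 1) i)]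
  · constructor
    · intro h j k h1 h2
      have := h j (by omega) k (by omega) h1
      linarith
    · intro h j _ k h2 h1
      have := h j k h1 (by omega)
      linarith

theorem IsLiftedMulticut.charVec_mem_ppp {M : Set (Sym2 (Fin (n + 1)))} (hn : 2 ≤ n)
    (hM : IsLiftedMulticut (path n) ⊤ M) : charVec ⊤ M ∈ ppp n := by
  classical
  obtain ⟨r, hr, hconv⟩ := hM.exists_label
  have hent : ∀ (i j : ℕ) (hi : i < n + 1) (hj : j < n + 1), i ≠ j →
      entry (charVec ⊤ M) i j = if r ⟨i, hi⟩ = r ⟨j, hj⟩ then 0 else 1 := by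
    intro i j hi hj h
    have h' : (⟨i, hi⟩ : Fin (n + 1)) ≠ ⟨j, hj⟩ := by simpa using h
    have := hr _ _ h'
    rw [entry_eq _ hi hj h, charVec]
    by_cases hc : r ⟨i, hi⟩ = r ⟨j, hj⟩
    · rw [if_pos hc, Set.indicator_of_notMem (by rw [this]; simpa using hc)]
    · rw [if_neg hc, Set.indicator_of_mem (this.2 hc), Pi.one_apply]
  rw [mem_ppp_iff]
  refine ⟨?_, ?_, ?_, ?_, ?_⟩
  · rw [hent 0 n (by omega) (by omega) (by omega)]
    split_ifs <;> norm_num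
  · intro i h0 h1
    rw [hent i n (by omega) (by omega) (by omega), hent (i - 1) n (by omega) (by omega) (by omega)]
    have := hconv ⟨i - 1, by omega⟩ ⟨i, by omega⟩ ⟨n, by omega⟩ (by simp [Fin.le_def])
      (by simp [Fin.le_def]; omega)
    split_ifs <;> first | (norm_num; done) | (exfalso; grind)
  · intro i h0 h1
    rw [hent 0 i (by omega) (by omega) (by omega), hent 0 (i + 1) (by omega) (by omega) (by omega)]
    have := hconv ⟨0, by omega⟩ ⟨i, by omega⟩ ⟨i + 1, by omega⟩ (by simp)
      (by simp [Fin.le_def])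
    split_ifs <;> first | (norm_num; done) | (exfalso; grind)
  · intro i h0 h1
    rw [hent (i - 1) i (by omega) (by omega) (by omega),
      hent (i - 1) (i + 1) (by omega) (by omega) (by omega),
      hent i (i + 1) (by omega) (by omega) (by omega)]
    split_ifs <;> first | (norm_num; done) | (exfalso; grind)
  · intro j k h1 h2
    rw [hent j k (by omega) (by omega) (by omega),
      hent (j + 1) (k - 1) (by omega) (by omega) (by omega),
      hent (j + 1) k (by omega) (by omega) (by omega),
      hent j (k - 1) (by omega) (by omega) (by omega)]
    have e1 := hconv ⟨j, by omega⟩ ⟨j + 1, by omega⟩ ⟨k, by omega⟩ (by simp [Fin.le_def])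
      (by simp [Fin.le_def]; omega)
    have e2 := hconv ⟨j, by omega⟩ ⟨k - 1, by omega⟩ ⟨k, by omega⟩ (by simp [Fin.le_def]; omega)
      (by simp [Fin.le_def])
    have e3 := hconv ⟨j, by omega⟩ ⟨j + 1, by omega⟩ ⟨k - 1, by omega⟩ (by simp [Fin.le_def])
      (by simp [Fin.le_def]; omega)
    have e4 := hconv ⟨j + 1, by omega⟩ ⟨k - 1, by omega⟩ ⟨k, by omega⟩
      (by simp [Fin.le_def]; omega) (by simp [Fin.le_def])
    -- Only the equality pattern of the four labels matters from here on.
    generalize r ⟨j, _⟩ = A at *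
    generalize r ⟨k, _⟩ = B at *
    generalize r ⟨j + 1, _⟩ = C at *
    generalize r ⟨k - 1, _⟩ = E at *
    split_ifs <;> first | (norm_num; done) | (exfalso; grind)

end Coordinates

end LiftedMulticut

namespace LiftedMulticut

/-! ### The dual certificate and its consequences -/

section Duality

variable {n : ℕ}

/-- A function of blocks `{j, …, k}`, read as a vector indexed by the rows of the system: the slack
of a row at the characteristic vector of a multicut indicates a block. -/
def rowVec (S : ℕ → ℕ → ℝ) : PathRows n → ℝ
  | .inl _ => S 0 n
  | .inr (.inl i) => S i n
  | .inr (.inr (.inl i)) => S 0 i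
  | .inr (.inr (.inr (.inl i))) => S i i
  | .inr (.inr (.inr (.inr p))) => S (p.1.1 + 1) (p.1.2 - 1)

theorem sum_inner_ite (f : ℕ → ℝ) (P : ℕ → Prop) [DecidablePred P] (a : ℕ)
    (h : ∀ i, 0 < i → i < n → P i → i = a) :
    ∑ i : Inner n, f i * (if P i then 1 else 0) = if P a ∧ 0 < a ∧ a < n then f a else 0 := by
  rw [Finset.sum_coe_sort (Finset.Ioo 0 n) fun i => f i * (if P i then 1 else 0)]
  split_ifs with hP
  · rw [Finset.sum_eq_single_of_mem a (Finset.mem_Ioo.2 hP.2)]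
    · simp [hP.1]
    · intro i hi hne
      rw [Finset.mem_Ioo] at hi
      rw [if_neg fun hPi => hne (h i hi.1 hi.2 hPi), mul_zero]
  · refine Finset.sum_eq_zero fun i hi => ?_
    rw [Finset.mem_Ioo] at hi
    rw [if_neg fun hPi => hP (h i hi.1 hi.2 hPi ▸ ⟨hPi, hi⟩), mul_zero]

theorem sum_farPairs_ite (f : ℕ → ℕ → ℝ) (P : ℕ → ℕ → Prop) [∀ j k, Decidable (P j k)] (a b : ℕ)
    (h : ∀ j k, j + 2 < k → P j k → j = a ∧ k = b) :
    ∑ p : FarPairs n, f p.1.1 p.1.2 * (if P p.1.1 p.1.2 then 1 else 0)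
      = if P a b ∧ a + 2 < b ∧ b ≤ n then f a b else 0 := by
  split_ifs with hP
  · rw [Finset.sum_eq_single_of_mem
      (⟨(⟨a, by omega⟩, ⟨b, by omega⟩), hP.2.1⟩ : FarPairs n) (Finset.mem_univ _)]
    · simp [hP.1]
    · rintro ⟨⟨j, k⟩, hjk⟩ - hne
      rw [if_neg, mul_zero]
      intro hPi
      obtain ⟨h1, h2⟩ := h _ _ hjk hPi
      exact hne (Subtype.ext (Prod.ext (Fin.ext h1) (Fin.ext h2)))
  · refine Finset.sum_eq_zero ?_
    rintro ⟨⟨j, k⟩, hjk⟩ -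
    rw [if_neg, mul_zero]
    intro hPi
    obtain ⟨h1, h2⟩ := h _ _ hjk hPi
    exact hP ⟨h1 ▸ h2 ▸ hPi, h1 ▸ h2 ▸ hjk, by omega⟩

theorem coord_mk {a b i j : ℕ} (ha : a < n + 1) (hb : b < n + 1) (hab : a < b) (hij : i < j)
    (he : s((⟨a, ha⟩ : Fin (n + 1)), ⟨b, hb⟩) ∈ (⊤ : SimpleGraph (Fin (n + 1))).edgeSet) :
    (coord n i j ⟨_, he⟩ : ℝ) = if i = a ∧ j = b then 1 else 0 := by
  have : s(a, b) = s(i, j) ↔ i = a ∧ j = b := by rw [Sym2.eq_iff]; omega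
  simp only [coord, Sym2.map_mk, this]
  split_ifs <;> simp

/-- The pair `{a, b}` occurs only in the rows of the four blocks on the right. The hypotheses on `S`
cover the blocks that have no row: `{0}`, `{n}` and the empty ones. -/
theorem sum_rowVec_mul_pathMatrix {S : ℕ → ℕ → ℝ} (hn : 2 ≤ n) (h0 : S 0 0 = 0) (h1 : S n n = 0)
    (hS : ∀ a, S (a + 1) a = 0) {a b : ℕ} (ha : a < n + 1) (hb : b < n + 1) (hab : a < b)
    (he : s((⟨a, ha⟩ : Fin (n + 1)), ⟨b, hb⟩) ∈ (⊤ : SimpleGraph (Fin (n + 1))).edgeSet) :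
    ∑ i, rowVec S i * (pathMatrix n i ⟨_, he⟩ : ℝ)
      = S a b - S (a + 1) b - S a (b - 1) + S (a + 1) (b - 1) := by
  have r1 : (coord n 0 n ⟨_, he⟩ : ℝ) = if 0 = a ∧ n = b then 1 else 0 :=
    coord_mk ha hb hab (by omega) he
  have r2 : ∑ i : Inner n, S i n * ((coord n i n ⟨_, he⟩ : ℝ) - coord n (i - 1) n ⟨_, he⟩)
      = (if (a = a ∧ n = b) ∧ 0 < a ∧ a < n then S a n else 0)
        - if (a + 1 - 1 = a ∧ n = b) ∧ 0 < a + 1 ∧ a + 1 < n then S (a + 1) n else 0 := by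
    rw [← sum_inner_ite (fun i => S i n) (fun i => i = a ∧ n = b) a (by omega),
      ← sum_inner_ite (fun i => S i n) (fun i => i - 1 = a ∧ n = b) (a + 1) (by omega),
      ← Finset.sum_sub_distrib]
    refine Finset.sum_congr rfl fun i _ => ?_
    have hi := Finset.mem_Ioo.1 i.2
    rw [coord_mk ha hb hab (by omega) he, coord_mk ha hb hab (by omega) he]
    ring
  have r3 : ∑ i : Inner n, S 0 i * ((coord n 0 i ⟨_, he⟩ : ℝ) - coord n 0 (i + 1) ⟨_, he⟩)
      = (if (0 = a ∧ b = b) ∧ 0 < b ∧ b < n then S 0 b else 0)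
        - if (0 = a ∧ b - 1 + 1 = b) ∧ 0 < b - 1 ∧ b - 1 < n then S 0 (b - 1) else 0 := by
    rw [← sum_inner_ite (fun i => S 0 i) (fun i => 0 = a ∧ i = b) b (by omega),
      ← sum_inner_ite (fun i => S 0 i) (fun i => 0 = a ∧ i + 1 = b) (b - 1) (by omega),
      ← Finset.sum_sub_distrib]
    refine Finset.sum_congr rfl fun i _ => ?_
    have hi := Finset.mem_Ioo.1 i.2
    rw [coord_mk ha hb hab (by omega) he, coord_mk ha hb hab (by omega) he]
    ring
  have r4 : ∑ i : Inner n, S i i * ((coord n (i - 1) (i + 1) ⟨_, he⟩ : ℝ)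
        - coord n (i - 1) i ⟨_, he⟩ - coord n i (i + 1) ⟨_, he⟩)
      = (if (a + 1 - 1 = a ∧ a + 1 + 1 = b) ∧ 0 < a + 1 ∧ a + 1 < n then S (a + 1) (a + 1) else 0)
        - (if (b - 1 = a ∧ b = b) ∧ 0 < b ∧ b < n then S b b else 0)
        - if (a = a ∧ a + 1 = b) ∧ 0 < a ∧ a < n then S a a else 0 := by
    rw [← sum_inner_ite (fun i => S i i) (fun i => i - 1 = a ∧ i + 1 = b) (a + 1) (by omega),
      ← sum_inner_ite (fun i => S i i) (fun i => i - 1 = a ∧ i = b) b (by omega),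
      ← sum_inner_ite (fun i => S i i) (fun i => i = a ∧ i + 1 = b) a (by omega),
      ← Finset.sum_sub_distrib, ← Finset.sum_sub_distrib]
    refine Finset.sum_congr rfl fun i _ => ?_
    have hi := Finset.mem_Ioo.1 i.2
    rw [coord_mk ha hb hab (by omega) he, coord_mk ha hb hab (by omega) he,
      coord_mk ha hb hab (by omega) he]
    ring
  have r5 : ∑ p : FarPairs n, S (p.1.1 + 1) (p.1.2 - 1) * ((coord n p.1.1 p.1.2 ⟨_, he⟩ : ℝ)
        + coord n (p.1.1 + 1) (p.1.2 - 1) ⟨_, he⟩ - coord n (p.1.1 + 1) p.1.2 ⟨_, he⟩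
        - coord n p.1.1 (p.1.2 - 1) ⟨_, he⟩)
      -- The guard `a - 1 + 1 = a` fails at `a = 0`, where truncated subtraction would otherwise
      -- name a nonexistent row.
      = (if (a = a ∧ b = b) ∧ a + 2 < b ∧ b ≤ n then S (a + 1) (b - 1) else 0)
        + (if (a - 1 + 1 = a ∧ b + 1 - 1 = b) ∧ a - 1 + 2 < b + 1 ∧ b + 1 ≤ n
            then S (a - 1 + 1) (b + 1 - 1) else 0)
        - (if (a - 1 + 1 = a ∧ b = b) ∧ a - 1 + 2 < b ∧ b ≤ n then S (a - 1 + 1) (b - 1) else 0)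
        - if (a = a ∧ b + 1 - 1 = b) ∧ a + 2 < b + 1 ∧ b + 1 ≤ n
            then S (a + 1) (b + 1 - 1) else 0 := by
    set f : ℕ → ℕ → ℝ := fun j k => S (j + 1) (k - 1) with hf
    rw [← sum_farPairs_ite f (fun j k => j = a ∧ k = b) a b (by omega),
      ← sum_farPairs_ite f (fun j k => j + 1 = a ∧ k - 1 = b) (a - 1) (b + 1) (by omega),
      ← sum_farPairs_ite f (fun j k => j + 1 = a ∧ k = b) (a - 1) b (by omega),
      ← sum_farPairs_ite f (fun j k => j = a ∧ k - 1 = b) a (b + 1) (by omega),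
      ← Finset.sum_add_distrib, ← Finset.sum_sub_distrib, ← Finset.sum_sub_distrib]
    refine Finset.sum_congr rfl fun p _ => ?_
    have hp := p.2
    rw [coord_mk ha hb hab (by omega) he, coord_mk ha hb hab (by omega) he,
      coord_mk ha hb hab (by omega) he, coord_mk ha hb hab (by omega) he]
    ring
  simp only [Fintype.sum_sum_type, Finset.univ_unique, Finset.sum_singleton, rowVec, pathMatrix,
    Pi.sub_apply, Pi.add_apply, Rat.cast_sub, Rat.cast_add]
  rw [r1, r2, r3, r4, r5]
  clear r1 r2 r3 r4 r5 he
  obtain ⟨c, rfl⟩ : ∃ c, b = c + 1 := ⟨b - 1, by omega⟩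
  have hSc := hS c
  have hSa := hS a
  rcases Nat.eq_zero_or_pos a with rfl | ha0
  · grind
  · obtain ⟨d, rfl⟩ : ∃ d, a = d + 1 := ⟨a - 1, by omega⟩
    grind

theorem exists_dual_certificate (hn : 2 ≤ n) (T : AddSubgroup ℝ) (c : Pairs n → ℝ)
    (hc : ∀ e, c e ∈ T) :
    ∃ y : PathRows n → ℝ, (∀ i, 0 ≤ y i) ∧ (∀ i, y i ∈ T) ∧
      (∀ e, ∑ i, y i * (pathMatrix n i e : ℝ) = c e) ∧
      ∃ M, IsLiftedMulticut (path n) ⊤ M ∧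
        ∑ i, y i * (pathRhs n i : ℝ) = ∑ e, c e * charVec ⊤ M e := by
  set D := entry c with hD
  have hDT : ∀ a b, D a b ∈ T := entry_mem hc
  set W := blockWeight D with hW
  have hWT : ∀ a b, W a b ∈ T := fun a b => pairWeight_mem hDT _ b
  have hW0 : ∀ a b, b ≤ a + 1 → W a b = 0 := fun a b h => blockWeight_eq_zero D h
  have hpath := exists_monotone_pairWeight_eq_shortestDist D
  have hle := @shortestDist_le W
  have hp0 := shortestDist_zero W
  set p := shortestDist W with hp
  have hpT : ∀ m, p m ∈ T := by
    intro m
    obtain ⟨f, -, -, hf⟩ := hpath m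
    rw [← hf]
    exact pairWeight_mem hDT _ m
  -- Lowering the potential at `n` to `p (n + 1)` makes the reduced cost of `{n}` vanish. Blocks
  -- ending at `n - 1` only gain; those starting at `n` reduce to `{n}` itself.
  obtain ⟨q, hqn, hq⟩ : ∃ q : ℕ → ℝ, q n = p (n + 1) ∧ ∀ m, m ≠ n → q m = p m :=
    ⟨Function.update p n (p (n + 1)), by simp, fun m hm => by simp [hm]⟩
  have hqT : ∀ m, q m ∈ T := by
    intro m
    rcases eq_or_ne m n with rfl | hm
    · rw [hqn]; exact hpT _
    · rw [hq m hm]; exact hpT _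
  set S : ℕ → ℕ → ℝ := fun a b => W a (b + 1) - q (b + 1) + q a with hSdef
  have hST : ∀ a b, S a b ∈ T := fun a b => T.add_mem (T.sub_mem (hWT _ _) (hqT _)) (hqT _)
  have hp1 : p 1 = 0 := by
    obtain ⟨j, hj, h⟩ := exists_shortestDist_eq W one_pos
    obtain rfl : j = 0 := by omega
    rw [hp, h, ← hp, hp0, hW0 0 1 le_rfl, add_zero]
  have hS0 : S 0 0 = 0 := by
    simp only [hSdef]
    rw [hW0 _ _ le_rfl, hq _ (by omega), hq _ (by omega), hp0, zero_add, hp1]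
    norm_num
  have hSn : S n n = 0 := by
    simp only [hSdef]
    rw [hW0 _ _ le_rfl, hq (n + 1) (by omega), hqn]
    ring
  have hSd : ∀ a, S (a + 1) a = 0 := by
    intro a
    simp only [hSdef]
    rw [hW0 _ _ (by omega)]
    ring
  have hpn : p (n + 1) ≤ p n := by
    have := hle (Nat.lt_succ_self n)
    rwa [hW0 _ _ le_rfl, add_zero] at this
  have hSnonneg : ∀ a b, a ≤ b → b ≤ n → 0 ≤ S a b := by
    intro a b hab hbn
    rcases eq_or_ne a n with rfl | han
    · obtain rfl : b = a := by omega
      exact hSn.ge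
    have h2 := hle (show a < b + 1 by omega)
    simp only [hSdef]
    rw [hq a han]
    rcases eq_or_ne (b + 1) n with h | h
    · rw [h, hqn]
      rw [h] at h2
      linarith
    · rw [hq _ h]
      linarith
  obtain ⟨f, hf, -, hfp⟩ := hpath (n + 1)
  obtain ⟨M, hM, hMf⟩ := exists_isLiftedMulticut_of_monotone (n := n) hf
  refine ⟨rowVec S, ?_, ?_, ?_, M, hM, ?_⟩
  · rintro (_ | i | i | i | i)
    · exact hSnonneg _ _ (by omega) le_rfl
    · exact hSnonneg _ _ (Finset.mem_Ioo.1 i.2).2.le le_rfl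
    · exact hSnonneg _ _ (by omega) (Finset.mem_Ioo.1 i.2).2.le
    · exact hSnonneg _ _ le_rfl (Finset.mem_Ioo.1 i.2).2.le
    · have := i.2
      exact hSnonneg _ _ (by omega) (by omega)
  · rintro (_ | i | i | i | i) <;> exact hST _ _
  · rintro ⟨e, he⟩
    obtain ⟨a, b, ha, hb, hab, rfl⟩ : ∃ (a b : ℕ) (ha : a < n + 1) (hb : b < n + 1), a < b ∧
        e = s((⟨a, ha⟩ : Fin (n + 1)), ⟨b, hb⟩) := by
      induction e using Sym2.ind with
      | _ u v =>
        have huv : u ≠ v := by simpa using he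
        rcases lt_or_gt_of_ne huv with h | h
        · exact ⟨u, v, u.2, v.2, h, rfl⟩
        · exact ⟨v, u, v.2, u.2, h, Sym2.eq_swap⟩
    -- The potentials `q` cancel in the second difference, leaving that of `W`.
    rw [sum_rowVec_mul_pathMatrix hn hS0 hSn hSd ha hb hab he, ← entry_eq c ha hb hab.ne,
      ← hD, ← blockWeight_second_difference D hab]
    obtain ⟨k, rfl⟩ : ∃ k, b = k + 1 := ⟨b - 1, by omega⟩
    simp only [hSdef, Nat.add_sub_cancel]
    ring
  · have hl : ∑ i, rowVec S i * (pathRhs n i : ℝ) = S 0 n := by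
      simp [Fintype.sum_sum_type, rowVec, pathRhs]
    have hent : ∀ b ∈ Finset.range (n + 1), ∀ a ∈ Finset.range b,
        entry (fun e => c e * charVec ⊤ M e) a b
          = (if 0 ≤ a then D a b else 0) - if f a = f b then D a b else 0 := by
      intro b hb a ha
      rw [Finset.mem_range] at hb ha
      rw [entry_eq _ (by omega) hb ha.ne, hD, entry_eq _ (by omega) hb ha.ne, charVec]
      have := hMf ⟨a, by omega⟩ ⟨b, hb⟩ (by simp; omega)
      by_cases h : f a = f b
      · rw [Set.indicator_of_notMem (by rw [this]; simpa using h)]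
        simp [h]
      · rw [Set.indicator_of_mem (this.2 h)]
        simp [h]
    rw [hl, sum_pairs, Finset.sum_congr rfl fun b hb => Finset.sum_congr rfl (hent b hb)]
    simp only [Finset.sum_sub_distrib]
    have h1 : ∑ b ∈ Finset.range (n + 1), ∑ a ∈ Finset.range b, (if 0 ≤ a then D a b else 0)
        = W 0 (n + 1) := rfl
    have h2 : ∑ b ∈ Finset.range (n + 1), ∑ a ∈ Finset.range b, (if f a = f b then D a b else 0)
        = p (n + 1) := hfp
    rw [h1, h2]
    simp only [hSdef]
    rw [hq _ (by omega), hq _ (by omega), hp0, add_zero]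

theorem sum_mul_le_of_mem_solutions {ι κ : Type*} [Fintype ι] [Fintype κ] {A : Matrix ι κ ℚ}
    {b : ι → ℚ} {x c : κ → ℝ} {y : ι → ℝ} (hx : x ∈ solutions A b) (hy : ∀ i, 0 ≤ y i)
    (hyc : ∀ e, ∑ i, y i * (A i e : ℝ) = c e) :
    ∑ e, c e * x e ≤ ∑ i, y i * (b i : ℝ) := by
  calc ∑ e, c e * x e = ∑ i, y i * ∑ e, (A i e : ℝ) * x e := by
        simp only [← hyc, Finset.sum_mul, Finset.mul_sum]
        rw [Finset.sum_comm]
        simp only [mul_assoc]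
    _ ≤ _ := Finset.sum_le_sum fun i _ => mul_le_mul_of_nonneg_left (hx i) (hy i)

theorem isTotallyDualIntegral_pathMatrix (hn : 2 ≤ n) :
    IsTotallyDualIntegral (pathMatrix n) (pathRhs n) := by
  intro c _ _
  -- The subgroup is the image of the integers in the reals.
  obtain ⟨y, hy0, hyT, hyc, M, hM, hyM⟩ := exists_dual_certificate hn
    (Int.castAddHom ℝ).range (fun e => (c e : ℝ)) fun e => ⟨c e, rfl⟩
  choose z hz using hyT
  obtain rfl : y = fun i => (z i : ℝ) := funext fun i => (hz i).symm
  refine ⟨z, ⟨hy0, hyc⟩, fun w hw => ?_⟩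
  rw [hyM]
  exact sum_mul_le_of_mem_solutions (hM.charVec_mem_ppp hn) hw.1 hw.2

theorem convex_solutions {ι κ : Type*} [Fintype κ] (A : Matrix ι κ ℚ) (b : ι → ℚ) :
    Convex ℝ (solutions A b) := by
  rw [show solutions A b = ⋂ i, {x : κ → ℝ | ∑ e, (A i e : ℝ) * x e ≤ b i} by
    ext; simp [solutions]]
  refine convex_iInter fun i => convex_halfSpace_le ⟨fun x y => ?_, fun r x => ?_⟩ _
  · simp [mul_add, Finset.sum_add_distrib]
  · simp [Finset.mul_sum, mul_left_comm]

theorem lmc_path_eq_ppp (hn : 2 ≤ n) : lmc (path n) = ppp n := by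
  refine subset_antisymm (convexHull_min ?_ (convex_solutions _ _)) fun x hx => ?_
  · rintro _ ⟨M, hM, rfl⟩
    exact hM.charVec_mem_ppp hn
  by_contra hxn
  -- Finitely many vertices make the hull closed, as strict separation needs.
  have hfin : {x | ∃ M, IsLiftedMulticut (path n) ⊤ M ∧ x = charVec ⊤ M}.Finite :=
    (Set.finite_range (charVec (⊤ : SimpleGraph (Fin (n + 1))))).subset <| by
      rintro _ ⟨M, -, rfl⟩
      exact ⟨M, rfl⟩
  obtain ⟨g, u, hgu, hux⟩ := geometric_hahn_banach_closed_point (convex_convexHull ℝ _)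
    (hfin.isClosed_convexHull ℝ) hxn
  classical
  have hg : ∀ z, g z = ∑ e, g (Pi.single e 1) * z e := by
    intro z
    conv_lhs => rw [pi_eq_sum_univ' z]
    simp [mul_comm]
  obtain ⟨y, hy0, -, hyc, M, hM, hyM⟩ := exists_dual_certificate hn ⊤
    (fun e => g (Pi.single e 1)) fun _ => AddSubgroup.mem_top _
  have h1 := sum_mul_le_of_mem_solutions hx hy0 hyc
  rw [hyM, ← hg, ← hg] at h1
  have h2 := hgu _ (subset_convexHull ℝ _ ⟨M, hM, rfl⟩)
  linarith

end Duality

end LiftedMulticut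

theorem mainTheorem3 (n : ℕ) (hn : 2 ≤ n) :
    LiftedMulticut.IsTotallyDualIntegral
        (LiftedMulticut.pathMatrix n) (LiftedMulticut.pathRhs n) ∧
      LiftedMulticut.lmc (LiftedMulticut.path n) = LiftedMulticut.ppp n :=
  ⟨LiftedMulticut.isTotallyDualIntegral_pathMatrix hn, LiftedMulticut.lmc_path_eq_ppp hn⟩
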